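/- Let $(\Omega,\mathcal F,\{\mathcal F_t\}_{t\ge 0},\mathbb P)$ be a filtered probability space carrying a standard one-dimensional $\{\mathcal F_t\}$-Brownian motion $B$ (with continuous paths), let $\sigma>0$, $\mu\neq\frac12\sigma^2$, $P_0>0$ be real constants, and let $P_t=P_0\exp\bigl((\mu-\tfrac12\sigma^2)t+\sigma B_t\bigr)$ be the geometric Brownian motion $dP_t=\mu P_t\,dt+\sigma P_t\,dB_t$. Put $\beta=\frac{-2\mu+\sigma^2}{\sigma^2}$, $S_t=P_t^{\beta}$ and $s=P_0^{\beta}$. Let $\mathcal T$ be the set of $\{\mathcal F_t\}$-stopping times $\tau$ with $\mathbb P(\tau<\infty)=1$. Let $w:[0,1]\to[0,1]$ be strictly increasing and absolutely continuous with $w(0)=0$, $w(1)=1$, and let $u:[0,\infty)\to[0,\infty)$ be nondecreasing and absolutely continuous on every compact interval, with $u(0)=0$. For $\tau\in\mathcal T$ set $$J(\tau)=\int_0^\infty w\bigl(\mathbb P(u(S_\tau)>x)\bigr)\,dx\in[0,\infty],$$ and for $0<a\le s\le b$ set $$f(a,b)=\Bigl(1-w\bigl(\tfrac{s-a}{b-a}\bigr)\Bigr)u(a)+w\bigl(\tfrac{s-a}{b-a}\bigr)u(b),$$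 with $f(s,s)=u(s)$. Theorem 4.5. If $u$ is convex (and $w$ has an arbitrary shape), then, as an identity in $[0,\infty]$, $$\sup_{\tau\in\mathcal T}J(\tau)=\sup_{0<a\le s\le b}f(a,b)=\sup_{x\in(0,1]}w(x)\,u\Bigl(\frac sx\Bigr).$$ Moreover, if $(a^*,b^*)$ with $0<a^*\le s\le b^*$ attains the maximum of $f$ over $\{(a,b):0<a\le s\le b\}$, then the stopping time $\tau_{(a^*,b^*)}$, defined as $\inf\{t\ge 0: S_t\notin(a^*,b^*)\}$ if $a^*<b^*$ and as $0$ if $a^*=b^*$, belongs to $\mathcal T$ and satisfies $J(\tau_{(a^*,b^*)})=\sup_{\tau\in\mathcal T}J(\tau)$. -/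

import Mathlib

open MeasureTheory ProbabilityTheory
open scoped NNReal ENNReal

namespace DistortedStopping

noncomputable section

/-- `B` is a standard one-dimensional Brownian motion on the filtered probability space
`(Ω, m, F, P)`: a Brownian motion with continuous paths which is adapted to `F` and whose
increments after time `r` are independent of `F r`. -/
structure IsStandardBM {Ω : Type*} {m : MeasurableSpace Ω} (F : Filtration ℝ≥0 m)
    (B : ℝ≥0 → Ω → ℝ) (P : Measure Ω) : Prop extends IsBrownianReal B P where
  continuous_path : ∀ ω, Continuous fun t => B t ω
  adapted : Adapted F B
  indep_increment : ∀ r t : ℝ≥0, r ≤ t →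
    Indep (MeasurableSpace.comap (fun ω => B t ω - B r ω) inferInstance) (F r) P

/-- Geometric Brownian motion `dP = μ P dt + σ P dB` with initial value `p₀`. -/
def gbm {Ω : Type*} (μ σ p₀ : ℝ) (B : ℝ≥0 → Ω → ℝ) (t : ℝ≥0) (ω : Ω) : ℝ :=
  p₀ * Real.exp ((μ - σ ^ 2 / 2) * (t : ℝ) + σ * B t ω)

/-- The exponent `β = (-2 μ + σ²) / σ²`. -/
def driftExponent (μ σ : ℝ) : ℝ := (-2 * μ + σ ^ 2) / σ ^ 2

/-- The auxiliary process `S_t = P_t ^ β`, where `P` is the geometric Brownian motion. -/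
def auxProcess {Ω : Type*} (μ σ p₀ : ℝ) (B : ℝ≥0 → Ω → ℝ) (t : ℝ≥0) (ω : Ω) : ℝ :=
  (gbm μ σ p₀ B t ω) ^ (driftExponent μ σ)

/-- The set of all almost surely finite stopping times of the filtration `F`. -/
def stoppingTimes {Ω : Type*} {m : MeasurableSpace Ω} (F : Filtration ℝ≥0 m)
    (P : Measure Ω) : Set (Ω → WithTop ℝ≥0) :=
  {τ | IsStoppingTime F τ ∧ ∀ᵐ ω ∂P, τ ω < ⊤}

/-- The distorted mean payoff `J(τ) = ∫₀^∞ w (P (u (S_τ) > x)) dx`, with values in `[0, ∞]`. -/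
def distortedPayoff {Ω : Type*} {m : MeasurableSpace Ω} (P : Measure Ω) (w u : ℝ → ℝ)
    (S : ℝ≥0 → Ω → ℝ) (τ : Ω → WithTop ℝ≥0) : ℝ≥0∞ :=
  ∫⁻ x in Set.Ioi (0 : ℝ), ENNReal.ofReal (w (P.real {ω | u (stoppedValue S τ ω) > x}))

/-- `τ` is an admissible stopping time that maximizes the distorted mean payoff. -/
def IsOptimalStopping {Ω : Type*} {m : MeasurableSpace Ω} (F : Filtration ℝ≥0 m)
    (P : Measure Ω) (w u : ℝ → ℝ) (S : ℝ≥0 → Ω → ℝ) (τ : Ω → WithTop ℝ≥0) : Prop :=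
  τ ∈ stoppingTimes F P ∧
    ∀ ρ ∈ stoppingTimes F P, distortedPayoff P w u S ρ ≤ distortedPayoff P w u S τ

/-- A probability distortion: a strictly increasing, absolutely continuous function on `[0, 1]`
with `w 0 = 0` and `w 1 = 1` (only the values on `[0, 1]` matter). -/
structure IsDistortion (w : ℝ → ℝ) : Prop where
  strictMonoOn : StrictMonoOn w (Set.Icc 0 1)
  absolutelyContinuous : AbsolutelyContinuousOnInterval w 0 1
  map_zero : w 0 = 0
  map_one : w 1 = 1

/-- A payoff function: nondecreasing on `[0, ∞)`, absolutely continuous on every compact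
subinterval, with `u 0 = 0` (only the values on `[0, ∞)` matter). -/
structure IsPayoff (u : ℝ → ℝ) : Prop where
  monotoneOn : MonotoneOn u (Set.Ici 0)
  absolutelyContinuous : ∀ M : ℝ, 0 ≤ M → AbsolutelyContinuousOnInterval u 0 M
  map_zero : u 0 = 0

/-- The pairs of thresholds `0 < a ≤ s ≤ b`. -/
def thresholds (s : ℝ) : Set (ℝ × ℝ) := {p | 0 < p.1 ∧ p.1 ≤ s ∧ s ≤ p.2}

/-- The two-threshold value `(1 - w ((s-a)/(b-a))) u a + w ((s-a)/(b-a)) u b`, `p = (a, b)`.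
For `a = b = s` it equals `u s`, whatever value in `[0, 1]` is given to the quotient. -/
def twoThreshold (w u : ℝ → ℝ) (s : ℝ) (p : ℝ × ℝ) : ℝ :=
  (1 - w ((s - p.1) / (p.2 - p.1))) * u p.1 + w ((s - p.1) / (p.2 - p.1)) * u p.2

open scoped Classical in
/-- The first exit time `inf {t ≥ 0 : S_t ∉ (a, b)}` if `a < b` (infinite if `S` never leaves
the interval), and the time `0` otherwise. -/
def exitTime {Ω : Type*} (S : ℝ≥0 → Ω → ℝ) (a b : ℝ) : Ω → WithTop ℝ≥0 :=
  if a < b then hittingAfter S (Set.Ioo a b)ᶜ 0 else fun _ => 0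

end

end DistortedStopping

namespace DistortedStopping

/-! The exponent is chosen so that `S` is a driftless exponential martingale, positive and starting
at `s`. Hence an almost surely finite stopping time gives `X = S_τ` with mean at most `s`, and it
suffices to prove a cycle of inequalities: payoffs ≤ supremum of `w x * u (s / x)` ≤ two-threshold
values ≤ payoffs.

The first inequality is `distorted_mean_le`. Let ν be the measure with distribution function `w`,
and `F y = P(X > y)`. By Tonelli the distorted mean of `u X` is at most the ν-integral over `p` of
`u (k p)`, with `k p` the quantile at tail level `p`. The supporting line of `u` at `k` gives `u k ≤
∫_0^k u (s / F y) * (F y / s) dy` (`ofReal_le_lintegral_of_convexOn`), using `∫ F ≤ s` and `u 0 =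
0`. Swapping the integrals back replaces the condition `p < F y` by the factor `w (F y)`; each `w (F
y) * u (s / F y)` is at most the supremum, and the remaining weight `F y / s` has total mass at most
1.

For the second, fix `x`, keep the probability of the upper threshold equal to `x`, and let the lower
one tend to 0 (`ofReal_le_iSup_twoThreshold`). For the third, the exit time of an interval is almost
surely finite and keeps the mean, so the exit value is a two-point law with mean `s`
(`distortedPayoff_exitTime`). -/

/-! ### Distortions and payoffs -/

/-- A distortion, extended by constants outside `[0, 1]`, as a Stieltjes function. -/
noncomputable def IsDistortion.stieltjes {w : ℝ → ℝ} (hw : IsDistortion w) :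
    StieltjesFunction ℝ where
  toFun := Set.IccExtend zero_le_one (Set.domRestrict (Set.Icc 0 1) w)
  mono' := Monotone.IccExtend _ fun x y h => hw.strictMonoOn.monotoneOn x.2 y.2 h
  right_continuous' x := by
    have : ContinuousOn w (Set.Icc 0 1) := by
      simpa using hw.absolutelyContinuous.continuousOn
    exact (this.domRestrict.Icc_extend' (h := zero_le_one)).continuousWithinAt

lemma IsDistortion.continuousOn {w : ℝ → ℝ} (hw : IsDistortion w) :
    ContinuousOn w (Set.Icc 0 1) := by
  simpa using hw.absolutelyContinuous.continuousOn

lemma IsDistortion.nonneg {w : ℝ → ℝ} (hw : IsDistortion w) {x : ℝ} (hx : x ∈ Set.Icc 0 1) :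
    0 ≤ w x := by
  have := hw.strictMonoOn.monotoneOn (by simp) hx hx.1
  rwa [hw.map_zero] at this

/-- Continuity of `w` rules out an atom at `q`, so the open interval loses no mass. This writes `w
q` as an integral of the indicator of `p < q`, ready for Tonelli. -/
lemma IsDistortion.measure_Ioo {w : ℝ → ℝ} (hw : IsDistortion w) {q : ℝ}
    (hq : q ∈ Set.Icc (0 : ℝ) 1) :
    hw.stieltjes.measure (Set.Ioo 0 q) = ENNReal.ofReal (w q) := by
  have hc : Continuous hw.stieltjes :=
    hw.continuousOn.domRestrict.Icc_extend' (h := zero_le_one)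
  rw [StieltjesFunction.measure_Ioo, hc.continuousAt.continuousWithinAt.leftLim_eq]
  have e : ∀ x (hx : x ∈ Set.Icc (0 : ℝ) 1), hw.stieltjes x = w x := fun x hx =>
    Set.IccExtend_of_mem zero_le_one (Set.domRestrict (Set.Icc 0 1) w) hx
  rw [e q hq, e 0 (by simp), hw.map_zero, sub_zero]

lemma IsPayoff.nonneg {u : ℝ → ℝ} (hu : IsPayoff u) {x : ℝ} (hx : 0 ≤ x) : 0 ≤ u x := by
  have := hu.monotoneOn (by simp) hx hx
  rwa [hu.map_zero] at this

lemma IsPayoff.measurable_comp {α : Type*} [MeasurableSpace α] {u : ℝ → ℝ} (hu : IsPayoff u)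
    {f : α → ℝ} (hf : Measurable f) (h0 : ∀ y, 0 ≤ f y) : Measurable fun y => u (f y) := by
  have hm : Monotone fun x => u (max x 0) := fun x y h =>
    hu.monotoneOn (by simp) (by simp) (max_le_max_right _ h)
  convert hm.measurable.comp hf using 1
  ext y
  simp [h0 y]

/-! ### Supporting lines and the Jensen type inequality -/

lemma exists_supporting_slope {u : ℝ → ℝ} (hconv : ConvexOn ℝ (Set.Ici 0) u) {k : ℝ}
    (hk : 0 < k) : ∃ c, ∀ z, 0 ≤ z → u k + c * (z - k) ≤ u z := by
  have hi : k ∈ interior (Set.Ici (0 : ℝ)) := by simpa using hk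
  refine ⟨derivWithin u (Set.Ioi k) k, fun z hz => ?_⟩
  rcases lt_trichotomy z k with h | rfl | h
  · have := (hconv.slope_le_leftDeriv_of_mem_interior hz hi h).trans
      (hconv.leftDeriv_le_rightDeriv_of_mem_interior hi)
    rw [slope_def_field, div_le_iff₀ (by linarith)] at this
    linarith
  · simp
  · have := hconv.rightDeriv_le_slope_of_mem_interior hi hz h
    rw [slope_def_field, le_div_iff₀ (by linarith)] at this
    linarith

/-- A Jensen type inequality: the value of a convex function vanishing at `0` at `k` is bounded
by a mixture of its values at the points `s / F y`. -/
lemma ofReal_le_lintegral_of_convexOn {u : ℝ → ℝ} (hu : IsPayoff u)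
    (hconv : ConvexOn ℝ (Set.Ici 0) u) {F : ℝ → ℝ} (hF : Antitone F) {s k : ℝ} (hs : 0 < s)
    (hk : 0 < k) (hpos : ∀ y ∈ Set.Ioo 0 k, 0 < F y)
    (hint : ∫⁻ y in Set.Ioi 0, ENNReal.ofReal (F y) ≤ ENNReal.ofReal s) :
    ENNReal.ofReal (u k) ≤
      ∫⁻ y in Set.Ioo 0 k, ENNReal.ofReal (u (s / F y)) * ENNReal.ofReal (F y / s) := by
  obtain ⟨c, hc⟩ := exists_supporting_slope hconv hk
  have hFint : IntegrableOn F (Set.Ioo 0 k) :=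
    (AntitoneOn.integrableOn_isCompact isCompact_Icc (hF.antitoneOn _)).mono_set
      Set.Ioo_subset_Icc_self
  have hθ : ∫ y in Set.Ioo 0 k, F y ≤ s := by
    rw [← ENNReal.ofReal_le_ofReal_iff hs.le, ofReal_integral_eq_lintegral_ofReal hFint]
    · exact (lintegral_mono_set Set.Ioo_subset_Ioi_self).trans hint
    · exact (ae_restrict_iff' measurableSet_Ioo).2 (.of_forall fun y hy => (hpos y hy).le)
  -- The supporting line at `k`, evaluated at `s / F y` and multiplied by `F y / s`, is this affine
  -- function of `F y`.
  have hLint : IntegrableOn (fun y => (u k - c * k) / s * F y + c) (Set.Ioo 0 k) :=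
    (hFint.const_mul _).add (by simp)
  have hL : u k ≤ ∫ y in Set.Ioo 0 k, ((u k - c * k) / s * F y + c) := by
    rw [integral_add (hFint.const_mul _) (by simp), integral_const_mul]
    -- The line at 0 gives `u k - c * k ≤ u 0 = 0`, so enlarging `∫ F` to `s` only lowers the bound.
    have h0 := hc 0 le_rfl
    rw [hu.map_zero] at h0
    have : (u k - c * k) / s * s ≤ (u k - c * k) / s * ∫ y in Set.Ioo 0 k, F y :=
      mul_le_mul_of_nonpos_left hθ (div_nonpos_of_nonpos_of_nonneg (by linarith) hs.le)
    rw [div_mul_cancel₀ _ hs.ne'] at this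
    have h3 : ∫ _ in Set.Ioo 0 k, c = k * c := by simp [hk.le]
    rw [h3]
    linarith
  -- The affine bound may be negative; its positive part is still below the nonnegative integrand.
  calc ENNReal.ofReal (u k)
      ≤ ENNReal.ofReal (∫ y in Set.Ioo 0 k, max ((u k - c * k) / s * F y + c) 0) :=
        ENNReal.ofReal_le_ofReal (hL.trans (integral_mono hLint hLint.pos_part
          fun y => le_max_left _ _))
    _ = ∫⁻ y in Set.Ioo 0 k, ENNReal.ofReal (max ((u k - c * k) / s * F y + c) 0) :=
        ofReal_integral_eq_lintegral_ofReal hLint.pos_part (.of_forall fun y => le_max_right _ _)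
    _ ≤ _ := by
        refine setLIntegral_mono' measurableSet_Ioo fun y hy => ?_
        have hy' := hpos y hy
        have hz : 0 ≤ s / F y := by positivity
        rw [← ENNReal.ofReal_mul (hu.nonneg hz)]
        refine ENNReal.ofReal_le_ofReal (max_le ?_ (mul_nonneg (hu.nonneg hz) (by positivity)))
        refine le_trans (le_of_eq ?_) (mul_le_mul_of_nonneg_right (hc _ hz)
          (by positivity : 0 ≤ F y / s))
        field_simp
        ring

/-! ### Tails, quantiles and the upper bound for distorted means -/

section Tail

variable {Ω : Type*} {m : MeasurableSpace Ω} {P : Measure Ω} [IsProbabilityMeasure P] {X : Ω → ℝ}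

lemma antitone_tail (P : Measure Ω) [IsProbabilityMeasure P] (X : Ω → ℝ) :
    Antitone fun y => P.real {ω | y < X ω} := fun _ _ h =>
  measureReal_mono fun _ hω => h.trans_lt hω

lemma tail_mem_Icc (P : Measure Ω) [IsProbabilityMeasure P] (A : Set Ω) :
    P.real A ∈ Set.Icc (0 : ℝ) 1 :=
  ⟨measureReal_nonneg, measureReal_le_one⟩

lemma lintegral_tail (h0 : ∀ ω, 0 ≤ X ω) (hX : AEMeasurable X P) :
    ∫⁻ y in Set.Ioi (0 : ℝ), ENNReal.ofReal (P.real {ω | y < X ω}) =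
      ∫⁻ ω, ENNReal.ofReal (X ω) ∂P := by
  rw [lintegral_eq_lintegral_meas_lt P (.of_forall h0) hX]
  simp [Measure.real]

/-- Right quantiles: there is a threshold beyond which the tail is at most `p`, and before which
it exceeds `p`. -/
lemma exists_quantile (h0 : ∀ ω, 0 ≤ X ω) (hX : AEMeasurable X P)
    (hfin : ∫⁻ ω, ENNReal.ofReal (X ω) ∂P ≠ ⊤) {p : ℝ} (hp : 0 < p) :
    ∃ k, 0 ≤ k ∧ P.real {ω | k < X ω} ≤ p ∧ ∀ y, 0 ≤ y → y < k → p < P.real {ω | y < X ω} := by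
  have hint : Integrable X P :=
    ⟨hX.aestronglyMeasurable, by
      rw [hasFiniteIntegral_iff_ofReal (.of_forall h0)]; exact hfin.lt_top⟩
  set A : Set ℝ := {y | 0 ≤ y ∧ P.real {ω | y < X ω} ≤ p}
  have hA : A.Nonempty := by
    have hi : 0 ≤ ∫ ω, X ω ∂P := integral_nonneg h0
    -- Markov's inequality at this level; the `+ 1` keeps it positive when the mean is 0.
    refine ⟨(∫ ω, X ω ∂P) / p + 1, by positivity, ?_⟩
    have h1 := mul_meas_ge_le_integral_of_nonneg (μ := P) (.of_forall h0) hint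
      ((∫ ω, X ω ∂P) / p + 1)
    have h2 : P.real {ω | (∫ ω, X ω ∂P) / p + 1 < X ω} ≤
        P.real {ω | (∫ ω, X ω ∂P) / p + 1 ≤ X ω} :=
      measureReal_mono (Set.ofPred_subset_ofPred.2 fun ω hω => hω.le)
    refine h2.trans (le_of_mul_le_mul_left (h1.trans ?_)
      (by positivity : 0 < (∫ ω, X ω ∂P) / p + 1))
    rw [add_mul, div_mul_cancel₀ _ hp.ne']
    linarith
  have hbdd : BddBelow A := ⟨0, fun y hy => hy.1⟩
  refine ⟨sInf A, le_csInf hA fun y hy => hy.1, ?_, fun y hy hlt => ?_⟩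
  -- The infimum is attained because the tail is right-continuous.
  · obtain ⟨v, hvm, hv0, hv⟩ :=
      exists_seq_strictAnti_tendsto' (show sInf A < sInf A + 1 by linarith)
    have hU : {ω | sInf A < X ω} = ⋃ n, {ω | v n < X ω} := by
      ext ω
      simp only [Set.mem_ofPred_eq, Set.mem_iUnion]
      exact ⟨fun h => (hv.eventually_lt_const h).exists, fun ⟨n, hn⟩ => (hv0 n).1.trans hn⟩
    have hmono : Monotone fun n => {ω | v n < X ω} := fun i j hij ω hω =>
      (hvm.antitone hij).trans_lt hω
    refine ENNReal.toReal_le_of_le_ofReal hp.le ?_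
    rw [hU, hmono.measure_iUnion]
    refine iSup_le fun n => ?_
    obtain ⟨y, hy, hyv⟩ := exists_lt_of_csInf_lt hA (hv0 n).1
    exact (ENNReal.le_ofReal_iff_toReal_le (measure_ne_top _ _) hp.le).2
      ((antitone_tail P X hyv.le).trans hy.2)
  · by_contra! h
    exact hlt.not_ge (csInf_le hbdd ⟨hy, h⟩)

/-- The distorted mean of `u X` is bounded by the best two-point value when `X` has mean at most
`s` and `u` is convex. -/
theorem distorted_mean_le {w u : ℝ → ℝ} (hw : IsDistortion w) (hu : IsPayoff u)
    (hconv : ConvexOn ℝ (Set.Ici 0) u) {s : ℝ} (hs : 0 < s) (h0 : ∀ ω, 0 ≤ X ω)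
    (hX : AEMeasurable X P) (hmean : ∫⁻ ω, ENNReal.ofReal (X ω) ∂P ≤ ENNReal.ofReal s) :
    ∫⁻ x in Set.Ioi (0 : ℝ), ENNReal.ofReal (w (P.real {ω | u (X ω) > x})) ≤
      ⨆ x ∈ Set.Ioc (0 : ℝ) 1, ENNReal.ofReal (w x * u (s / x)) := by
  set F : ℝ → ℝ := fun y => P.real {ω | y < X ω} with hF
  set G : ℝ → ℝ := fun x => P.real {ω | x < u (X ω)} with hG
  -- Restricting to `p > 0` matters: quantiles exist only at positive levels.
  set ν := hw.stieltjes.measure.restrict (Set.Ioi 0) with hν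
  set M := ⨆ x ∈ Set.Ioc (0 : ℝ) 1, ENNReal.ofReal (w x * u (s / x)) with hM
  set g : ℝ → ℝ≥0∞ := fun y => ENNReal.ofReal (u (s / F y)) * ENNReal.ofReal (F y / s) with hg
  have hFm : Measurable F := (antitone_tail P X).measurable
  have hGm : Measurable G := (antitone_tail P fun ω => u (X ω)).measurable
  have hF01 : ∀ y, F y ∈ Set.Icc (0 : ℝ) 1 := fun y => tail_mem_Icc P _
  have hgm : Measurable g :=
    (hu.measurable_comp (measurable_const.div hFm) fun y =>
      div_nonneg hs.le (hF01 y).1).ennreal_ofReal.mul (hFm.div_const s).ennreal_ofReal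
  have hνIio : ∀ q ∈ Set.Icc (0 : ℝ) 1, ν (Set.Iio q) = ENNReal.ofReal (w q) := fun q hq => by
    rw [hν, Measure.restrict_apply measurableSet_Iio, Set.Iio_inter_Ioi, hw.measure_Ioo hq]
  have hFint : ∫⁻ y in Set.Ioi 0, ENNReal.ofReal (F y) ≤ ENNReal.ofReal s :=
    (lintegral_tail h0 hX).trans_le hmean
  have hsets : MeasurableSet {z : ℝ × ℝ | z.2 < G z.1} :=
    measurableSet_lt measurable_snd (hGm.comp measurable_fst)
  have hsets' : MeasurableSet {z : ℝ × ℝ | z.1 < F z.2} :=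
    measurableSet_lt measurable_fst (hFm.comp measurable_snd)
  have hm : Measurable (Function.uncurry fun x p => (Set.Iio (G x)).indicator (1 : ℝ → ℝ≥0∞) p) :=
    Measurable.indicator measurable_one hsets
  have hm' : Measurable (Function.uncurry fun p y => (Set.Iio (F y)).indicator (fun _ => g y) p) :=
    (hgm.comp measurable_snd).indicator hsets'
  have key : ∀ p : ℝ, 0 < p →
      ∫⁻ x in Set.Ioi (0 : ℝ), (Set.Iio (G x)).indicator 1 p ≤
        ∫⁻ y in Set.Ioi (0 : ℝ), (Set.Iio (F y)).indicator (fun _ => g y) p := by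
    intro p hp
    obtain ⟨k, hk0, hkp, hk⟩ := exists_quantile h0 hX (hmean.trans_lt ENNReal.ofReal_lt_top).ne hp
    have h1 : ∫⁻ x in Set.Ioi (0 : ℝ), (Set.Iio (G x)).indicator (1 : ℝ → ℝ≥0∞) p ≤
        ENNReal.ofReal (u k) := by
      calc _ ≤ ∫⁻ x in Set.Ioi (0 : ℝ), (Set.Ioo 0 (u k)).indicator (1 : ℝ → ℝ≥0∞) x := by
            refine setLIntegral_mono' measurableSet_Ioi fun x hx => ?_
            by_cases hpx : p < G x
            · have : x < u k := by
                -- If `u k ≤ x`, monotonicity puts `u X > x` inside `X > k`, an event of probability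
                -- at most `p`.
                by_contra! hle
                refine hpx.not_ge (le_trans (measureReal_mono fun ω hω => ?_) hkp)
                by_contra! hlt
                have := hu.monotoneOn (h0 ω) hk0 (not_lt.1 hlt)
                exact absurd (hle.trans_lt hω) (not_lt.2 this)
              rw [Set.indicator_of_mem (show x ∈ Set.Ioo 0 (u k) from ⟨hx, this⟩)]
              exact Set.indicator_le_self' (by simp) _
            · rw [Set.indicator_of_notMem (by simpa using hpx)]
              exact zero_le
        _ ≤ ∫⁻ x, (Set.Ioo 0 (u k)).indicator (1 : ℝ → ℝ≥0∞) x := setLIntegral_le_lintegral _ _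
        _ = _ := by simp [lintegral_indicator_one measurableSet_Ioo]
    refine h1.trans ?_
    rcases hk0.eq_or_lt with rfl | hkpos
    · simp [hu.map_zero]
    calc ENNReal.ofReal (u k) ≤ ∫⁻ y in Set.Ioo 0 k, g y :=
          ofReal_le_lintegral_of_convexOn hu hconv (antitone_tail P X) hs hkpos
            (fun y hy => hp.trans (hk y hy.1.le hy.2)) hFint
      _ = ∫⁻ y in Set.Ioo 0 k, (Set.Iio (F y)).indicator (fun _ => g y) p :=
          setLIntegral_congr_fun measurableSet_Ioo fun y hy =>
            (Set.indicator_of_mem (s := Set.Iio (F y)) (hk y hy.1.le hy.2) fun _ => g y).symm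
      _ ≤ _ := lintegral_mono_set Set.Ioo_subset_Ioi_self
  calc ∫⁻ x in Set.Ioi (0 : ℝ), ENNReal.ofReal (w (G x))
      = ∫⁻ x in Set.Ioi (0 : ℝ), ∫⁻ p, (Set.Iio (G x)).indicator 1 p ∂ν := by
        refine lintegral_congr fun x => ?_
        rw [lintegral_indicator_one measurableSet_Iio, hνIio _ (tail_mem_Icc P _)]
    _ = ∫⁻ p, (∫⁻ x in Set.Ioi (0 : ℝ), (Set.Iio (G x)).indicator 1 p) ∂ν :=
        lintegral_lintegral_swap hm.aemeasurable
    _ ≤ ∫⁻ p, (∫⁻ y in Set.Ioi (0 : ℝ), (Set.Iio (F y)).indicator (fun _ => g y) p) ∂ν := by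
        rw [hν]
        exact setLIntegral_mono' measurableSet_Ioi key
    _ = ∫⁻ y in Set.Ioi (0 : ℝ), ∫⁻ p, (Set.Iio (F y)).indicator (fun _ => g y) p ∂ν :=
        lintegral_lintegral_swap (μ := ν) hm'.aemeasurable
    _ = ∫⁻ y in Set.Ioi (0 : ℝ), g y * ENNReal.ofReal (w (F y)) := by
        refine lintegral_congr fun y => ?_
        rw [lintegral_indicator_const measurableSet_Iio, hνIio _ (hF01 y)]
    _ ≤ ∫⁻ y in Set.Ioi (0 : ℝ), M * ENNReal.ofReal (F y / s) := by
        refine lintegral_mono fun y => ?_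
        rcases (hF01 y).1.eq_or_lt with h | h
        · simp [hg, ← h]
        · have : ENNReal.ofReal (w (F y) * u (s / F y)) ≤ M :=
            le_iSup₂_of_le (F y) ⟨h, (hF01 y).2⟩ le_rfl
          refine le_trans (le_of_eq ?_) (mul_le_mul_left this _)
          rw [ENNReal.ofReal_mul (hw.nonneg (hF01 y))]
          ring
    _ = M * ∫⁻ y in Set.Ioi (0 : ℝ), ENNReal.ofReal (F y / s) :=
        lintegral_const_mul _ (hFm.div_const s).ennreal_ofReal
    _ ≤ M * 1 := by
        gcongr
        simp_rw [ENNReal.ofReal_div_of_pos hs, div_eq_mul_inv]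
        rw [lintegral_mul_const _ hFm.ennreal_ofReal, ← div_eq_mul_inv]
        exact ENNReal.div_le_of_le_mul (by simpa using hFint)
    _ = M := mul_one M

end Tail

/-! ### Optional stopping in continuous time -/

section OptionalStopping

open Filter Topology

variable {Ω : Type*} {m : MeasurableSpace Ω} {P : Measure Ω} [IsProbabilityMeasure P]
  {F : Filtration ℝ≥0 m}

/-- The discretization from above of a nonnegative real. -/
noncomputable def ceilGrid (n : ℕ) (x : ℝ≥0) : ℝ≥0 := ⌈x * (n + 1)⌉₊ / (n + 1)

lemma ceilGrid_le_iff (n : ℕ) (x t : ℝ≥0) :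
    ceilGrid n x ≤ t ↔ x ≤ ⌊t * (n + 1)⌋₊ / (n + 1) := by
  have hn : (0 : ℝ≥0) < n + 1 := by positivity
  rw [ceilGrid, div_le_iff₀ hn, le_div_iff₀ hn, ← Nat.ceil_le, Nat.le_floor_iff (by positivity)]

lemma le_ceilGrid (n : ℕ) (x : ℝ≥0) : x ≤ ceilGrid n x := by
  rw [ceilGrid, le_div_iff₀ (by positivity)]
  exact Nat.le_ceil _

lemma ceilGrid_le (n : ℕ) (x : ℝ≥0) : ceilGrid n x ≤ x + 1 / (n + 1) := by
  have hn : (0 : ℝ≥0) < n + 1 := by positivity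
  rw [ceilGrid, div_le_iff₀ hn, add_mul, one_div, inv_mul_cancel₀ hn.ne']
  exact (Nat.ceil_lt_add_one (by positivity)).le

lemma tendsto_ceilGrid (x : ℝ≥0) : Tendsto (fun n => ceilGrid n x) atTop (𝓝 x) := by
  refine tendsto_of_tendsto_of_tendsto_of_le_of_le tendsto_const_nhds ?_
    (fun n => le_ceilGrid n x) (fun n => ceilGrid_le n x)
  simpa using tendsto_const_nhds.add (tendsto_one_div_add_atTop_nhds_zero_nat (𝕜 := ℝ≥0))

/-- Whether the rounded time has passed by `t` depends only on `σ` up to the last grid point not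
exceeding `t`. -/
lemma isStoppingTime_ceilGrid {σ : Ω → ℝ≥0} (hσ : IsStoppingTime F fun ω => (σ ω : WithTop ℝ≥0))
    (n : ℕ) : IsStoppingTime F fun ω => (ceilGrid n (σ ω) : WithTop ℝ≥0) := by
  intro t
  have hle : (⌊t * (n + 1)⌋₊ / (n + 1) : ℝ≥0) ≤ t := by
    rw [div_le_iff₀ (by positivity)]
    exact Nat.floor_le (by positivity)
  have := F.mono hle _ (hσ (⌊t * (n + 1)⌋₊ / (n + 1)))
  simpa only [WithTop.coe_le_coe, ceilGrid_le_iff] using this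

/-- Optional stopping for continuous martingales at bounded stopping times. -/
theorem optional_stopping {f : ℝ≥0 → Ω → ℝ} (hf : Martingale f F P)
    (hc : ∀ ω, Continuous fun t => f t ω) {σ : Ω → ℝ≥0}
    (hσ : IsStoppingTime F fun ω => (σ ω : WithTop ℝ≥0)) {N : ℝ≥0} (hN : ∀ ω, σ ω ≤ N) :
    Integrable (fun ω => f (σ ω) ω) P ∧ ∫ ω, f (σ ω) ω ∂P = ∫ ω, f 0 ω ∂P := by
  -- Rounding adds at most 1, so all discretized values are conditional expectations of the single
  -- variable `f (N + 1)`; this yields uniform integrability.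
  have hle : ∀ n ω, (ceilGrid n (σ ω) : WithTop ℝ≥0) ≤ (N + 1 : ℝ≥0) := fun n ω => by
    refine WithTop.coe_le_coe.2 ((ceilGrid_le n _).trans (add_le_add (hN ω) ?_))
    rw [div_le_iff₀ (by positivity)]
    simp
  have hst := isStoppingTime_ceilGrid hσ
  have hcount : ∀ n, (Set.range fun ω => (ceilGrid n (σ ω) : WithTop ℝ≥0)).Countable := fun n => by
    refine (Set.countable_range fun k : ℕ => ((k / (n + 1) : ℝ≥0) : WithTop ℝ≥0)).mono ?_
    rintro _ ⟨ω, rfl⟩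
    exact ⟨_, rfl⟩
  have hae : ∀ n, (fun ω => f (ceilGrid n (σ ω)) ω) =ᵐ[P] P[f (N + 1) | (hst n).measurableSpace] :=
    fun n => hf.stoppedValue_ae_eq_condExp_of_le_const_of_countable_range (hst n) (hle n) (hcount n)
  have hui : UniformIntegrable (fun n ω => f (ceilGrid n (σ ω)) ω) 1 P :=
    (uniformIntegrable_congr_ae hae).2
      ((hf.integrable (N + 1)).uniformIntegrable_condExp fun n => (hst n).measurableSpace_le)
  have hlim : ∀ᵐ ω ∂P, Tendsto (fun n => f (ceilGrid n (σ ω)) ω) atTop (𝓝 (f (σ ω) ω)) :=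
    .of_forall fun ω => ((hc ω).tendsto _).comp (tendsto_ceilGrid _)
  have hint := hui.integrable_of_tendstoInMeasure
    (tendstoInMeasure_of_tendsto_ae (fun n => hui.1 n) hlim)
  refine ⟨hint, ?_⟩
  have hL1 := tendsto_Lp_finite_of_tendsto_ae le_rfl ENNReal.one_ne_top (fun n => hui.1 n)
    (memLp_one_iff_integrable.2 hint) hui.2.1 hlim
  have hconv := tendsto_integral_of_L1' _ hint.aestronglyMeasurable
    (.of_forall fun n => memLp_one_iff_integrable.1 (hui.memLp n)) hL1
  refine tendsto_nhds_unique hconv ((tendsto_congr fun n => ?_).2 tendsto_const_nhds)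
  rw [integral_congr_ae (hae n), integral_condExp, ← integral_condExp (F.le 0),
    integral_congr_ae (hf.condExp_ae_eq zero_le)]

lemma coe_untopA_min (x : WithTop ℝ≥0) (N : ℝ≥0) :
    ((min x N).untopA : WithTop ℝ≥0) = min x N := by
  rw [WithTop.untopA_eq_untop (min_lt_of_right_lt (WithTop.coe_lt_top N)).ne, WithTop.coe_untop]

lemma isStoppingTime_coe_untopA_min {τ : Ω → WithTop ℝ≥0} (hτ : IsStoppingTime F τ) (N : ℝ≥0) :
    IsStoppingTime F fun ω => ((min (τ ω) N).untopA : WithTop ℝ≥0) := by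
  simpa only [coe_untopA_min] using hτ.min_const N

lemma untopA_min_le {x : WithTop ℝ≥0} {N : ℝ≥0} : (min x N).untopA ≤ N :=
  WithTop.untopA_le (min_le_right _ _)

lemma eventually_untopA_min {x : WithTop ℝ≥0} (hx : x < ⊤) :
    ∀ᶠ n : ℕ in atTop, (min x ((n : ℝ≥0) : WithTop ℝ≥0)).untopA = x.untopA := by
  lift x to ℝ≥0 using hx.ne
  filter_upwards [eventually_ge_atTop ⌈x⌉₊] with n hn
  rw [min_eq_left (WithTop.coe_le_coe.2 (Nat.ceil_le.1 hn))]

omit [IsProbabilityMeasure P] in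
lemma aemeasurable_stoppedValue {f : ℝ≥0 → Ω → ℝ} (hf : StronglyAdapted F f)
    (hc : ∀ ω, Continuous fun t => f t ω) {τ : Ω → WithTop ℝ≥0} (hτ : IsStoppingTime F τ) :
    AEMeasurable (stoppedValue f τ) P :=
  ((measurable_stoppedValue (hf.isStronglyProgressive_of_continuous hc) hτ).mono
    hτ.measurableSpace_le le_rfl).aemeasurable

/-- A nonnegative continuous martingale has smaller mean at an almost surely finite stopping
time. -/
theorem lintegral_stoppedValue_le {f : ℝ≥0 → Ω → ℝ} (hf : Martingale f F P)
    (hc : ∀ ω, Continuous fun t => f t ω) (h0 : ∀ t ω, 0 ≤ f t ω) {τ : Ω → WithTop ℝ≥0}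
    (hτ : τ ∈ stoppingTimes F P) :
    ∫⁻ ω, ENNReal.ofReal (stoppedValue f τ ω) ∂P ≤ ENNReal.ofReal (∫ ω, f 0 ω ∂P) := by
  -- Truncate at `n`, apply the bounded case, and pass to the limit by Fatou.
  have hos := fun n : ℕ => optional_stopping hf hc (isStoppingTime_coe_untopA_min hτ.1 n)
    fun ω => untopA_min_le
  have hfat := lintegral_liminf_le' (μ := P) (u := atTop)
    (f := fun (n : ℕ) ω => ENNReal.ofReal (f (min (τ ω) ((n : ℝ≥0) : WithTop ℝ≥0)).untopA ω))
    fun n => (hos n).1.aemeasurable.ennreal_ofReal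
  calc _ = ∫⁻ ω, liminf (fun n : ℕ =>
          ENNReal.ofReal (f (min (τ ω) ((n : ℝ≥0) : WithTop ℝ≥0)).untopA ω)) atTop ∂P := by
        refine lintegral_congr_ae (hτ.2.mono fun ω hω => Eq.symm (Tendsto.liminf_eq ?_))
        refine tendsto_const_nhds.congr' ((eventually_untopA_min hω).mono fun n hn => ?_)
        simp only [hn, stoppedValue]
    _ ≤ _ := hfat
    _ = _ := by
        refine (Filter.liminf_congr (.of_forall fun n => ?_)).trans (liminf_const _)
        rw [← ofReal_integral_eq_lintegral_ofReal (hos n).1 (.of_forall fun ω => h0 _ _), (hos n).2]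

/-- A continuous martingale which stays bounded up to an almost surely finite stopping time keeps
its mean. -/
theorem integral_stoppedValue_eq {f : ℝ≥0 → Ω → ℝ} (hf : Martingale f F P)
    (hc : ∀ ω, Continuous fun t => f t ω) {τ : Ω → WithTop ℝ≥0} (hτ : τ ∈ stoppingTimes F P)
    {C : ℝ} (hC : ∀ᵐ ω ∂P, ∀ t : ℝ≥0, t ≤ τ ω → |f t ω| ≤ C) :
    ∫ ω, stoppedValue f τ ω ∂P = ∫ ω, f 0 ω ∂P := by
  have hos := fun n : ℕ => optional_stopping hf hc (isStoppingTime_coe_untopA_min hτ.1 n)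
    fun ω => untopA_min_le
  have := tendsto_integral_of_dominated_convergence (μ := P) (f := stoppedValue f τ)
    (F := fun (n : ℕ) ω => f (min (τ ω) ((n : ℝ≥0) : WithTop ℝ≥0)).untopA ω) (fun _ => C)
    (fun n => (hos n).1.aestronglyMeasurable) (integrable_const C)
    (fun n => hC.mono fun ω h => h _ ?_)
    (hτ.2.mono fun ω hω => tendsto_const_nhds.congr'
      ((eventually_untopA_min hω).mono fun n hn => by simp only [hn, stoppedValue]))
  · exact tendsto_nhds_unique this (tendsto_const_nhds.congr fun n => ((hos n).2).symm)
  · rw [coe_untopA_min]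
    exact min_le_left _ _

end OptionalStopping

/-! ### The exponential martingale of Brownian motion -/

section ExponentialMartingale

open Filter Topology

variable {Ω : Type*} {m : MeasurableSpace Ω} {P : Measure Ω}
  {F : Filtration ℝ≥0 m} {B : ℝ≥0 → Ω → ℝ}

/-- The exponential martingale of Brownian motion with volatility `c` and initial value `s`. -/
noncomputable def expMartingale (c s : ℝ) (B : ℝ≥0 → Ω → ℝ) (t : ℝ≥0) (ω : Ω) : ℝ :=
  s * Real.exp (c * B t ω - c ^ 2 / 2 * t)

omit m in
-- With β the exponent, `(μ - σ²/2) β = -(βσ)²/2`, exactly the Itô correction.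
lemma auxProcess_eq_expMartingale {μ σ p₀ : ℝ} (hσ : 0 < σ) (hp₀ : 0 < p₀) :
    auxProcess μ σ p₀ B =
      expMartingale (driftExponent μ σ * σ) (p₀ ^ driftExponent μ σ) B := by
  ext t ω
  rw [auxProcess, gbm, expMartingale, Real.mul_rpow hp₀.le (Real.exp_pos _).le, ← Real.exp_mul]
  congr 2
  simp only [driftExponent]
  field_simp
  ring

omit m in
lemma expMartingale_pos {c s : ℝ} (hs : 0 < s) (t : ℝ≥0) (ω : Ω) :
    0 < expMartingale c s B t ω := mul_pos hs (Real.exp_pos _)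

lemma continuous_expMartingale (hB : IsStandardBM F B P) (c s : ℝ) (ω : Ω) :
    Continuous fun t => expMartingale c s B t ω := by
  have := hB.continuous_path ω
  unfold expMartingale
  fun_prop

lemma integrable_exp_increment (hB : IsStandardBM F B P) (c : ℝ) (r t : ℝ≥0) :
    Integrable (fun ω => Real.exp (c * (B t ω - B r ω))) P := by
  have h := hB.hasLaw_sub t r
  have := integrable_exp_mul_gaussianReal (μ := 0) (v := nndist t.1 r.1) c
  rw [← h.map_eq, integrable_map_measure (by fun_prop) h.aemeasurable] at this
  exact this

lemma integral_exp_increment (hB : IsStandardBM F B P) (c : ℝ) {r t : ℝ≥0} (hrt : r ≤ t) :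
    ∫ ω, Real.exp (c * (B t ω - B r ω)) ∂P = Real.exp (c ^ 2 / 2 * (t - r)) := by
  have h := mgf_gaussianReal (hB.hasLaw_sub t r).map_eq c
  have hd : (nndist (t : ℝ) r : ℝ) = t - r := by
    rw [coe_nndist, Real.dist_eq, abs_of_nonneg (sub_nonneg.2 (NNReal.coe_le_coe.2 hrt))]
  rw [mgf] at h
  refine h.trans ?_
  rw [show ((nndist t.1 r.1 : ℝ≥0) : ℝ) = t - r from hd]
  congr 1
  ring

lemma integrable_exp_eval (hB : IsStandardBM F B P) (c : ℝ) (t : ℝ≥0) :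
    Integrable (fun ω => Real.exp (c * B t ω)) P := by
  refine (integrable_exp_increment hB c 0 t).congr ?_
  filter_upwards [hB.eval_zero_ae_eq_zero] with ω hω
  rw [hω, sub_zero]

lemma integral_exp_eval (hB : IsStandardBM F B P) (c : ℝ) (t : ℝ≥0) :
    ∫ ω, Real.exp (c * B t ω) ∂P = Real.exp (c ^ 2 / 2 * t) := by
  have h := integral_exp_increment hB c (zero_le (a := t))
  rw [NNReal.coe_zero, sub_zero] at h
  rw [← h]
  refine integral_congr_ae ?_
  filter_upwards [hB.eval_zero_ae_eq_zero] with ω hω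
  rw [hω, sub_zero]

lemma expMartingale_zero_ae (hB : IsStandardBM F B P) (c s : ℝ) :
    ∀ᵐ ω ∂P, expMartingale c s B 0 ω = s := by
  filter_upwards [hB.eval_zero_ae_eq_zero] with ω hω
  simp [expMartingale, hω]

theorem martingale_expMartingale [IsProbabilityMeasure P] (hB : IsStandardBM F B P) (c s : ℝ) :
    Martingale (expMartingale c s B) F P := by
  have had : StronglyAdapted F (expMartingale c s B) := fun t => by
    have := hB.adapted t
    unfold expMartingale
    exact (((this.const_mul c).sub_const _).exp.const_mul s).stronglyMeasurable
  have hint : ∀ t, Integrable (expMartingale c s B t) P := fun t => by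
    refine ((integrable_exp_eval hB c t).const_mul (s * Real.exp (-(c ^ 2 / 2 * t)))).congr
      (.of_forall fun ω => ?_)
    simp only [expMartingale]
    rw [mul_assoc, ← Real.exp_add]
    ring_nf
  refine ⟨had, fun r t hrt => ?_⟩
  -- The multiplicative increment: independent of the past and of mean 1.
  set Y : Ω → ℝ := fun ω => Real.exp (c * (B t ω - B r ω) - c ^ 2 / 2 * (t - r)) with hY
  have hYe : Y = fun ω => Real.exp (-(c ^ 2 / 2 * (t - r))) * Real.exp (c * (B t ω - B r ω)) := by
    ext ω
    rw [hY, ← Real.exp_add]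
    ring_nf
  have hYint : Integrable Y P := by
    rw [hYe]
    exact (integrable_exp_increment hB c r t).const_mul _
  have hYmean : ∫ ω, Y ω ∂P = 1 := by
    rw [hYe, integral_const_mul, integral_exp_increment hB c hrt, ← Real.exp_add]
    simp
  have hprod : expMartingale c s B t = expMartingale c s B r * Y := by
    ext ω
    simp only [expMartingale, hY, Pi.mul_apply]
    rw [mul_assoc, ← Real.exp_add]
    ring_nf
  have hYm : StronglyMeasurable[MeasurableSpace.comap (fun ω => B t ω - B r ω) inferInstance] Y :=
    Measurable.stronglyMeasurable
      ((((comap_measurable fun ω => B t ω - B r ω).const_mul c).sub_const _).exp)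
  have hle : MeasurableSpace.comap (fun ω => B t ω - B r ω) inferInstance ≤ m :=
    (((hB.adapted t).mono (F.le t) le_rfl).sub
      ((hB.adapted r).mono (F.le r) le_rfl)).comap_le
  have hY1 := condExp_indep_eq hle (F.le r) hYm (hB.indep_increment r t hrt)
  rw [hprod]
  refine (condExp_mul_of_stronglyMeasurable_left (had r) (hprod ▸ hint t) hYint).trans ?_
  filter_upwards [hY1] with ω hω
  rw [Pi.mul_apply, hω, hYmean, mul_one]

/-- The exponential martingale tends to `0` in probability. -/
lemma tendsto_measure_le_expMartingale [IsProbabilityMeasure P] (hB : IsStandardBM F B P)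
    {c s a : ℝ} (hc : c ≠ 0)
    (hs : 0 < s) (ha : 0 < a) :
    Tendsto (fun n : ℕ => P.real {ω | a ≤ expMartingale c s B n ω}) atTop (𝓝 0) := by
  have hbound : ∀ n : ℕ, P.real {ω | a ≤ expMartingale c s B n ω} ≤
      √(s / a) * Real.exp (-(c ^ 2 / 8)) ^ n := fun n => by
    -- Markov's inequality is applied to the square root: the martingale keeps its mean, but the
    -- mean of its root decays like `exp (-c² n / 8)`.
    have hint := (integrable_exp_eval hB (c / 2) n).const_mul
      (√s * Real.exp (-(c ^ 2 / 4 * n)))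
    have hmk := mul_meas_ge_le_integral_of_nonneg (μ := P) (.of_forall fun ω => by positivity)
      hint √a
    rw [integral_const_mul, integral_exp_eval hB, mul_assoc, ← Real.exp_add] at hmk
    have hsub : {ω | a ≤ expMartingale c s B n ω} ⊆
        {ω | √a ≤ √s * Real.exp (-(c ^ 2 / 4 * n)) * Real.exp (c / 2 * B n ω)} := by
      refine Set.ofPred_subset_ofPred.2 fun ω hω => ?_
      refine (Real.sqrt_le_sqrt hω).trans (le_of_eq ?_)
      rw [expMartingale, Real.sqrt_mul hs.le, mul_assoc, ← Real.exp_add, ← Real.exp_half]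
      simp only [NNReal.coe_natCast]
      ring_nf
    refine (measureReal_mono hsub).trans ?_
    rw [← mul_le_mul_iff_right₀ (Real.sqrt_pos.2 ha)]
    refine hmk.trans (le_of_eq ?_)
    rw [Real.sqrt_div hs.le, ← Real.exp_nat_mul]
    have := (Real.sqrt_pos.2 ha).ne'
    field_simp
    simp only [NNReal.coe_natCast]
    ring_nf
  refine squeeze_zero (fun n => measureReal_nonneg) hbound ?_
  have hc2 : 0 < c ^ 2 := by positivity
  simpa using (tendsto_pow_atTop_nhds_zero_of_lt_one (Real.exp_pos _).le
    (Real.exp_lt_one_iff.2 (by linarith : -(c ^ 2 / 8) < 0))).const_mul √(s / a)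

end ExponentialMartingale

/-! ### First exit from an open interval -/

section ExitTime

open Filter Topology

variable {Ω : Type*} {m : MeasurableSpace Ω} {P : Measure Ω}
  {F : Filtration ℝ≥0 m} {S : ℝ≥0 → Ω → ℝ} {a b : ℝ}

lemma exitTime_of_lt (hab : a < b) : exitTime S a b = hittingAfter S (Set.Ioo a b)ᶜ 0 :=
  if_pos hab

lemma exists_exit_eq (hc : ∀ ω, Continuous fun t => S t ω) (hab : a < b) {ω : Ω}
    (h : ∃ r, S r ω ∈ (Set.Ioo a b)ᶜ) :
    ∃ r : ℝ≥0, exitTime S a b ω = r ∧ S r ω ∈ (Set.Ioo a b)ᶜ := by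
  classical
  have hclosed : IsClosed {i : ℝ≥0 | 0 ≤ i ∧ S i ω ∈ (Set.Ioo a b)ᶜ} := by
    simp only [zero_le, true_and]
    exact isOpen_Ioo.isClosed_compl.preimage (hc ω)
  have hmem := hclosed.csInf_mem (h.imp fun r hr => ⟨zero_le, hr⟩) (OrderBot.bddBelow _)
  refine ⟨_, ?_, hmem.2⟩
  rw [exitTime_of_lt hab, hittingAfter, if_pos (h.imp fun r hr => ⟨zero_le, hr⟩)]

lemma mem_Ioo_of_lt_exitTime (hab : a < b) {ω : Ω} {t : ℝ≥0} (ht : t < exitTime S a b ω) :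
    S t ω ∈ Set.Ioo a b := by
  rw [exitTime_of_lt hab] at ht
  exact not_not.1 (notMem_of_lt_hittingAfter ht zero_le)

lemma exitTime_le_iff (hc : ∀ ω, Continuous fun t => S t ω) (hab : a < b) {ω : Ω} {t : ℝ≥0} :
    exitTime S a b ω ≤ t ↔ ∃ r ≤ t, S r ω ∈ (Set.Ioo a b)ᶜ := by
  refine ⟨fun h => ?_, fun ⟨r, hr, hS⟩ => ?_⟩
  · by_cases hex : ∃ r, S r ω ∈ (Set.Ioo a b)ᶜ
    · obtain ⟨r, hr, hS⟩ := exists_exit_eq hc hab hex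
      exact ⟨r, by rwa [hr, WithTop.coe_le_coe] at h, hS⟩
    · have : exitTime S a b ω = ⊤ := by
        rw [exitTime_of_lt hab, hittingAfter_eq_top_iff]
        exact fun j _ hj => hex ⟨j, hj⟩
      exact absurd (top_le_iff.1 (this ▸ h)) (WithTop.coe_ne_top)
  · by_contra! hlt
    exact hS (mem_Ioo_of_lt_exitTime hab ((WithTop.coe_le_coe.2 hr).trans_lt hlt))

/-- A continuous path stays in an open interval up to time `t` iff it stays uniformly inside,
tested at countably many times. -/
lemma forall_mem_Ioo_iff {x : ℝ≥0 → ℝ} (hx : Continuous x) {D : Set ℝ≥0} (hD : Dense D)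
    (t : ℝ≥0) : (∀ r ≤ t, x r ∈ Set.Ioo a b) ↔
      ∃ n : ℕ, ∀ r ∈ D, x (min r t) ∈ Set.Icc (a + 1 / (n + 1)) (b - 1 / (n + 1)) := by
  constructor
  -- Extrema over `[0, t]` are attained, which leaves a uniform margin.
  · intro h
    obtain ⟨r₁, h₁, hmin⟩ := (isCompact_Icc (a := (0 : ℝ≥0)) (b := t)).exists_isMinOn
      ⟨0, by simp⟩ hx.continuousOn
    obtain ⟨r₂, h₂, hmax⟩ := (isCompact_Icc (a := (0 : ℝ≥0)) (b := t)).exists_isMaxOn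
      ⟨0, by simp⟩ hx.continuousOn
    have e₁ := (h r₁ h₁.2).1
    have e₂ := (h r₂ h₂.2).2
    obtain ⟨n, hn⟩ := exists_nat_one_div_lt (lt_min (sub_pos.2 e₁) (sub_pos.2 e₂))
    refine ⟨n, fun r _ => ?_⟩
    have hr : min r t ∈ Set.Icc 0 t := ⟨zero_le, min_le_right _ _⟩
    have m₁ : x r₁ ≤ x (min r t) := hmin hr
    have m₂ : x (min r t) ≤ x r₂ := hmax hr
    constructor <;> linarith [lt_min_iff.1 hn]
  · rintro ⟨n, hn⟩ r hr
    -- Stopping the path at `t` lets a dense set of times control the endpoint too; closedness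
    -- extends the bound to all times.
    have hcl : IsClosed {r | x (min r t) ∈ Set.Icc (a + 1 / ((n : ℝ) + 1)) (b - 1 / (n + 1))} :=
      isClosed_Icc.preimage (hx.comp (continuous_id.min continuous_const))
    have hmem : r ∈ {r | x (min r t) ∈ Set.Icc (a + 1 / ((n : ℝ) + 1)) (b - 1 / (n + 1))} :=
      hcl.closure_subset_iff.2 hn (hD r)
    rw [Set.mem_ofPred_eq, min_eq_left hr] at hmem
    have : (0 : ℝ) < 1 / (n + 1) := by positivity
    exact ⟨by linarith [hmem.1], by linarith [hmem.2]⟩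

lemma isStoppingTime_exitTime (hS : Adapted F S) (hc : ∀ ω, Continuous fun t => S t ω)
    (hab : a < b) : IsStoppingTime F (exitTime S a b) := by
  intro t
  obtain ⟨D, hDc, hD⟩ := TopologicalSpace.exists_countable_dense ℝ≥0
  have : {ω | exitTime S a b ω ≤ t} = (⋃ n : ℕ, ⋂ r ∈ D,
      {ω | S (min r t) ω ∈ Set.Icc (a + 1 / ((n : ℝ) + 1)) (b - 1 / (n + 1))})ᶜ := by
    ext ω
    have := forall_mem_Ioo_iff (a := a) (b := b) (hc ω) hD t
    simp only [Set.mem_ofPred_eq, exitTime_le_iff hc hab, Set.mem_compl_iff, Set.mem_iUnion,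
      Set.mem_iInter, ← this]
    push Not
    rfl
  rw [this]
  exact (MeasurableSet.iUnion fun n => MeasurableSet.biInter hDc fun r _ =>
    F.mono (min_le_right r t) _ (hS _ measurableSet_Icc)).compl

/-- Before exit the path is in the open interval, so by continuity it is in the closure at exit.
Time 0 has no earlier times and needs `h0`. -/
lemma mem_Icc_of_le_exitTime (hc : ∀ ω, Continuous fun t => S t ω) (hab : a < b) {ω : Ω}
    (h0 : S 0 ω ∈ Set.Icc a b) {t : ℝ≥0} (ht : t ≤ exitTime S a b ω) : S t ω ∈ Set.Icc a b := by
  rcases (zero_le (a := t)).eq_or_lt with rfl | hpos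
  · exact h0
  · have hcl : IsClosed {r | S r ω ∈ Set.Icc a b} := isClosed_Icc.preimage (hc ω)
    have hsub : Set.Iio t ⊆ {r | S r ω ∈ Set.Icc a b} := fun r hr =>
      Set.Ioo_subset_Icc_self (mem_Ioo_of_lt_exitTime hab ((WithTop.coe_lt_coe.2 hr).trans_le ht))
    have := hcl.closure_subset_iff.2 hsub
    rw [closure_Iio' (a := t) ⟨0, hpos⟩] at this
    exact this (Set.mem_Iic.2 le_rfl)

lemma stoppedValue_exitTime (hc : ∀ ω, Continuous fun t => S t ω) (hab : a < b) {ω : Ω}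
    (h0 : S 0 ω ∈ Set.Icc a b) (hfin : exitTime S a b ω < ⊤) :
    stoppedValue S (exitTime S a b) ω = a ∨ stoppedValue S (exitTime S a b) ω = b := by
  have hex : ∃ r, S r ω ∈ (Set.Ioo a b)ᶜ := by
    by_contra! h
    refine hfin.ne ?_
    rw [exitTime_of_lt hab, hittingAfter_eq_top_iff]
    exact fun j _ => h j
  obtain ⟨r, hr, hS⟩ := exists_exit_eq hc hab hex
  have hI := mem_Icc_of_le_exitTime hc hab h0 hr.ge
  rw [stoppedValue, hr, WithTop.untopA, WithTop.untopD_coe]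
  by_contra! hne
  exact hS ⟨lt_of_le_of_ne hI.1 hne.1.symm, lt_of_le_of_ne hI.2 hne.2⟩

end ExitTime

/-! ### Distorted means of two-point laws -/

section TwoPoint

open Filter Topology

variable {Ω : Type*} {m : MeasurableSpace Ω} {P : Measure Ω} [IsProbabilityMeasure P]

/-- The distorted mean of a monotone function of a two-valued random variable. -/
lemma distorted_mean_of_two_values {w u : ℝ → ℝ} (hw : IsDistortion w) (hu : IsPayoff u) {a b : ℝ}
    (ha : 0 ≤ a) (hab : a < b) {Y : Ω → ℝ} (hY : ∀ᵐ ω ∂P, Y ω = a ∨ Y ω = b) :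
    ∫⁻ x in Set.Ioi (0 : ℝ), ENNReal.ofReal (w (P.real {ω | u (Y ω) > x})) =
      ENNReal.ofReal ((1 - w (P.real {ω | Y ω = b})) * u a + w (P.real {ω | Y ω = b}) * u b) := by
  set q := P.real {ω | Y ω = b}
  have hq : q ∈ Set.Icc (0 : ℝ) 1 := tail_mem_Icc P _
  have hua := hu.nonneg ha
  have huab : u a ≤ u b := hu.monotoneOn ha (ha.trans hab.le) hab.le
  -- The tail of `u Y` equals 1 below `u a`, `q` from `u a` to `u b`, and 0 beyond.
  have h1 : ∀ x ∈ Set.Ici (0 : ℝ), ENNReal.ofReal (w (P.real {ω | u (Y ω) > x})) =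
      (Set.Ico 0 (u a)).indicator (fun _ => 1) x +
        (Set.Ico (u a) (u b)).indicator (fun _ => ENNReal.ofReal (w q)) x := by
    intro x hx
    rcases lt_or_ge x (u a) with h | h
    · have : P.real {ω | u (Y ω) > x} = 1 := by
        rw [← probReal_univ (μ := P)]
        refine measureReal_congr (hY.mono fun ω hω => ?_)
        refine propext ⟨fun _ => trivial, fun _ => ?_⟩
        change x < u (Y ω)
        rcases hω with e | e <;> rw [e]
        exacts [h, h.trans_le huab]
      rw [this, hw.map_one, Set.indicator_of_mem (s := Set.Ico 0 (u a)) ⟨hx, h⟩,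
        Set.indicator_of_notMem (s := Set.Ico (u a) (u b)) fun h' => h.not_ge h'.1]
      simp
    · rw [Set.indicator_of_notMem (s := Set.Ico 0 (u a)) fun h' => h.not_gt h'.2, zero_add]
      rcases lt_or_ge x (u b) with h' | h'
      · have : P.real {ω | u (Y ω) > x} = q := by
          refine measureReal_congr (hY.mono fun ω hω => ?_)
          change (x < u (Y ω)) = (Y ω = b)
          rcases hω with e | e <;> rw [e]
          · simp [h.not_gt, hab.ne]
          · simp [h']
        rw [this, Set.indicator_of_mem (s := Set.Ico (u a) (u b)) ⟨h, h'⟩]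
      · have : P.real {ω | u (Y ω) > x} = 0 := by
          rw [← measureReal_empty (μ := P)]
          refine measureReal_congr (hY.mono fun ω hω => ?_)
          refine propext ⟨fun hlt => ?_, fun h => h.elim⟩
          change x < u (Y ω) at hlt
          rcases hω with e | e <;> rw [e] at hlt
          exacts [h.not_gt hlt, h'.not_gt hlt]
        rw [this, hw.map_zero,
          Set.indicator_of_notMem (s := Set.Ico (u a) (u b)) fun h'' => h'.not_gt h''.2]
        simp
  rw [setLIntegral_congr Ioi_ae_eq_Ici, setLIntegral_congr_fun measurableSet_Ici h1,
    lintegral_add_left (measurable_const.indicator measurableSet_Ico),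
    setLIntegral_indicator measurableSet_Ico, setLIntegral_indicator measurableSet_Ico,
    Set.inter_eq_left.2 Set.Ico_subset_Ici_self,
    Set.inter_eq_left.2 (Set.Ico_subset_Ici_self.trans (Set.Ici_subset_Ici.2 hua)),
    setLIntegral_const, setLIntegral_const, Real.volume_Ico, Real.volume_Ico,
    ← ENNReal.ofReal_mul (hw.nonneg hq), one_mul, ← ENNReal.ofReal_add (by linarith)
    (mul_nonneg (hw.nonneg hq) (by linarith))]
  congr 1
  ring

end TwoPoint

/-! ### Attaining and bounding the value -/

section Optimality

open Filter Topology

variable {Ω : Type*} {m : MeasurableSpace Ω} {P : Measure Ω} [IsProbabilityMeasure P]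
  {F : Filtration ℝ≥0 m} {B : ℝ≥0 → Ω → ℝ} {w u : ℝ → ℝ} {c s a b : ℝ}

lemma integral_expMartingale_zero (hB : IsStandardBM F B P) (c s : ℝ) :
    ∫ ω, expMartingale c s B 0 ω ∂P = s := by
  rw [integral_congr_ae (expMartingale_zero_ae hB c s)]
  simp

lemma exitTime_mem_stoppingTimes (hB : IsStandardBM F B P) (hc : c ≠ 0)
    (hp : (a, b) ∈ thresholds s) : exitTime (expMartingale c s B) a b ∈ stoppingTimes F P := by
  obtain ⟨ha, has, hsb⟩ : 0 < a ∧ a ≤ s ∧ s ≤ b := hp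
  rcases (has.trans hsb).eq_or_lt with rfl | hab
  · rw [exitTime, if_neg (lt_irrefl _)]
    exact ⟨isStoppingTime_const F 0, .of_forall fun ω => WithTop.coe_lt_top 0⟩
  have hcont := continuous_expMartingale hB c s
  refine ⟨isStoppingTime_exitTime
    (fun t => ((martingale_expMartingale hB c s).stronglyAdapted t).measurable) hcont hab, ?_⟩
  have hlim := tendsto_measure_le_expMartingale hB hc (ha.trans_le has) ha
  rw [ae_iff]
  -- A path that never exits stays above `a` at every integer time, and the probability of that
  -- tends to 0.
  have hle : ∀ n : ℕ, P.real {ω | ¬ exitTime (expMartingale c s B) a b ω < ⊤} ≤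
      P.real {ω | a ≤ expMartingale c s B n ω} := fun n =>
    measureReal_mono (Set.ofPred_subset_ofPred.2 fun ω hω =>
      (mem_Ioo_of_lt_exitTime hab ((not_lt_top_iff.1 hω) ▸ WithTop.coe_lt_top _)).1.le)
  exact (measureReal_eq_zero_iff (measure_ne_top P _)).1
    (le_antisymm (ge_of_tendsto' hlim hle) measureReal_nonneg)

/-- The exit time from `(a, b)` realizes the two-threshold value. -/
theorem distortedPayoff_exitTime (hB : IsStandardBM F B P) (hc : c ≠ 0) (hw : IsDistortion w)
    (hu : IsPayoff u) (hp : (a, b) ∈ thresholds s) :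
    distortedPayoff P w u (expMartingale c s B) (exitTime (expMartingale c s B) a b) =
      ENNReal.ofReal (twoThreshold w u s (a, b)) := by
  have hτ := exitTime_mem_stoppingTimes hB hc hp
  obtain ⟨ha, has, hsb⟩ : 0 < a ∧ a ≤ s ∧ s ≤ b := hp
  have hzero := expMartingale_zero_ae hB c s
  rcases (has.trans hsb).eq_or_lt with rfl | hab
  · obtain rfl : a = s := le_antisymm has hsb
    -- Degenerate case `a = b = s`: `a + 1` is a dummy second value, taken with probability 0.
    have hY : ∀ᵐ ω ∂P, stoppedValue (expMartingale c a B) (exitTime (expMartingale c a B) a a) ω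
        = a ∨ stoppedValue (expMartingale c a B) (exitTime (expMartingale c a B) a a) ω
          = a + 1 := by
      rw [exitTime, if_neg (lt_irrefl _)]
      exact hzero.mono fun ω hω => .inl hω
    have hb : P.real {ω | stoppedValue (expMartingale c a B)
        (exitTime (expMartingale c a B) a a) ω = a + 1} = 0 := by
      rw [← measureReal_empty (μ := P)]
      refine measureReal_congr (hzero.mono fun ω hω => propext ⟨fun h => ?_, fun h => h.elim⟩)
      change stoppedValue _ _ ω = _ at h
      rw [exitTime, if_neg (lt_irrefl _)] at h
      have h' : a = a + 1 := hω.symm.trans h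
      linarith
    rw [distortedPayoff, distorted_mean_of_two_values hw hu ha.le (lt_add_one a) hY, hb]
    simp [twoThreshold, hw.map_zero]
  have hcont := continuous_expMartingale hB c s
  set τ := exitTime (expMartingale c s B) a b
  set Y := stoppedValue (expMartingale c s B) τ
  have hY : ∀ᵐ ω ∂P, Y ω = a ∨ Y ω = b := by
    filter_upwards [hzero, hτ.2] with ω h0 hfin
    exact stoppedValue_exitTime hcont hab (by rw [h0]; exact ⟨has, hsb⟩) hfin
  have hmean : ∫ ω, Y ω ∂P = s := by
    rw [integral_stoppedValue_eq (martingale_expMartingale hB c s) hcont hτ (C := b),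
      integral_expMartingale_zero hB]
    filter_upwards [hzero] with ω h0 t ht
    have := mem_Icc_of_le_exitTime hcont hab (by rw [h0]; exact ⟨has, hsb⟩) ht
    rw [abs_of_nonneg (ha.le.trans this.1)]
    exact this.2
  have hYm : AEMeasurable Y P := aemeasurable_stoppedValue
    (martingale_expMartingale hB c s).stronglyAdapted hcont hτ.1
  have hnull : NullMeasurableSet {ω | Y ω = b} P :=
    hYm.nullMeasurableSet_preimage (measurableSet_singleton b)
  have hq : P.real {ω | Y ω = b} = (s - a) / (b - a) := by
    -- Taking means gives `s = a + q (b - a)`, which determines `q`.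
    have hYe : Y =ᵐ[P] fun ω => a + {ω | Y ω = b}.indicator (fun _ => b - a) ω := by
      filter_upwards [hY] with ω hω
      rcases hω with e | e
      · rw [Set.indicator_of_notMem (s := {ω | Y ω = b}) (fun h => hab.ne (e.symm.trans h)), e, add_zero]
      · rw [Set.indicator_of_mem (show ω ∈ {ω | Y ω = b} from e), e]
        ring
    rw [integral_congr_ae hYe, integral_add (integrable_const a)
      ((integrable_const _).indicator₀ hnull), integral_indicator₀ hnull] at hmean
    simp only [integral_const, probReal_univ, smul_eq_mul, one_mul, measureReal_restrict_apply_univ]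
      at hmean
    rw [eq_div_iff (sub_pos.2 hab).ne']
    linarith
  rw [distortedPayoff, distorted_mean_of_two_values hw hu ha.le hab hY, hq]
  rfl

theorem distortedPayoff_le (hB : IsStandardBM F B P) (hs : 0 < s) (hw : IsDistortion w)
    (hu : IsPayoff u) (hconv : ConvexOn ℝ (Set.Ici 0) u) {τ : Ω → WithTop ℝ≥0}
    (hτ : τ ∈ stoppingTimes F P) :
    distortedPayoff P w u (expMartingale c s B) τ ≤
      ⨆ x ∈ Set.Ioc (0 : ℝ) 1, ENNReal.ofReal (w x * u (s / x)) := by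
  have hcont := continuous_expMartingale hB c s
  have hM := martingale_expMartingale hB c s
  refine distorted_mean_le hw hu hconv hs (fun ω => (expMartingale_pos hs _ ω).le)
    (aemeasurable_stoppedValue hM.stronglyAdapted hcont hτ.1) ?_
  have := lintegral_stoppedValue_le hM hcont (fun t ω => (expMartingale_pos hs t ω).le) hτ
  rwa [integral_expMartingale_zero hB] at this

/-- Letting the lower threshold tend to `0`. -/
lemma ofReal_le_iSup_twoThreshold (hw : IsDistortion w) (hu : IsPayoff u) (hs : 0 < s) {x : ℝ}
    (hx : x ∈ Set.Ioc (0 : ℝ) 1) :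
    ENNReal.ofReal (w x * u (s / x)) ≤
      ⨆ p ∈ thresholds s, ENNReal.ofReal (twoThreshold w u s p) := by
  have hx0 := hx.1
  have hx1 := hx.2
  have hcu : ContinuousAt u (s / x) := by
    have hpos : 0 < s / x := by positivity
    have := (hu.absolutelyContinuous (s / x + 1) (by positivity)).continuousOn
    rw [Set.uIcc_of_le (by positivity)] at this
    exact this.continuousAt (Icc_mem_nhds hpos (lt_add_one _))
  have hg : ContinuousAt (fun a : ℝ => a + (s - a) / x) 0 := by fun_prop
  have hlim : Tendsto (fun a : ℝ => ENNReal.ofReal (w x * u (a + (s - a) / x))) (𝓝[>] 0)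
      (𝓝 (ENNReal.ofReal (w x * u (s / x)))) := by
    refine ((ENNReal.continuous_ofReal.tendsto _).comp (Tendsto.const_mul _ ?_)).mono_left
      nhdsWithin_le_nhds
    refine Tendsto.comp (g := u) (y := 𝓝 (s / x)) hcu ?_
    simpa [ContinuousAt] using hg
  refine le_of_tendsto hlim ?_
  filter_upwards [Ioo_mem_nhdsGT hs] with a ha
  have hsx : s - a ≤ (s - a) / x := by
    rw [le_div_iff₀ hx0]
    exact mul_le_of_le_one_right (by linarith [ha.2]) hx1
  -- This upper threshold makes the hitting probability exactly `x`; the lower threshold's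
  -- contribution is nonnegative and dropped.
  refine le_iSup₂_of_le (a, a + (s - a) / x) ⟨ha.1, ha.2.le, by linarith⟩
    (ENNReal.ofReal_le_ofReal ?_)
  have hne : s - a ≠ 0 := by linarith [ha.2]
  have hquot : (s - a) / (a + (s - a) / x - a) = x := by
    rw [add_sub_cancel_left]
    field_simp
  simp only [twoThreshold, hquot]
  have hw1 : w x ≤ 1 := by
    rw [← hw.map_one]
    exact hw.strictMonoOn.monotoneOn ⟨hx0.le, hx1⟩ (by simp) hx1
  linarith [mul_nonneg (sub_nonneg.2 hw1) (hu.nonneg ha.1.le)]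

end Optimality

end DistortedStopping

theorem theorem4p5 {Ω : Type*} {m : MeasurableSpace Ω} (P : Measure Ω) [IsProbabilityMeasure P]
    (F : Filtration ℝ≥0 m) (B : ℝ≥0 → Ω → ℝ) (hB : DistortedStopping.IsStandardBM F B P)
    (μ σ p₀ : ℝ) (hσ : 0 < σ) (hμ : μ ≠ σ ^ 2 / 2) (hp₀ : 0 < p₀)
    (S : ℝ≥0 → Ω → ℝ) (hS : S = DistortedStopping.auxProcess μ σ p₀ B)
    (s : ℝ) (hs : s = p₀ ^ DistortedStopping.driftExponent μ σ)
    (w u : ℝ → ℝ) (hw : DistortedStopping.IsDistortion w) (hu : DistortedStopping.IsPayoff u)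
    (hconv : ConvexOn ℝ (Set.Ici 0) u) :
    (⨆ τ ∈ DistortedStopping.stoppingTimes F P, DistortedStopping.distortedPayoff P w u S τ) =
        ⨆ p ∈ DistortedStopping.thresholds s,
          ENNReal.ofReal (DistortedStopping.twoThreshold w u s p) ∧
      (⨆ p ∈ DistortedStopping.thresholds s,
          ENNReal.ofReal (DistortedStopping.twoThreshold w u s p)) =
        ⨆ x ∈ Set.Ioc (0 : ℝ) 1, ENNReal.ofReal (w x * u (s / x)) ∧
      ∀ a b : ℝ, (a, b) ∈ DistortedStopping.thresholds s →
        IsMaxOn (DistortedStopping.twoThreshold w u s) (DistortedStopping.thresholds s) (a, b) →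
        DistortedStopping.IsOptimalStopping F P w u S (DistortedStopping.exitTime S a b) := by
  have hS' := hS.trans (DistortedStopping.auxProcess_eq_expMartingale (B := B) (μ := μ) hσ hp₀)
  rw [← hs] at hS'
  have hs0 : 0 < s := hs ▸ Real.rpow_pos_of_pos hp₀ _
  have hc : DistortedStopping.driftExponent μ σ * σ ≠ 0 := by
    refine mul_ne_zero (div_ne_zero (fun h => hμ ?_) (by positivity)) hσ.ne'
    linarith
  rw [hS']
  set c := DistortedStopping.driftExponent μ σ * σ
  have hJ : (⨆ p ∈ DistortedStopping.thresholds s,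
      ENNReal.ofReal (DistortedStopping.twoThreshold w u s p)) ≤
      ⨆ τ ∈ DistortedStopping.stoppingTimes F P,
        DistortedStopping.distortedPayoff P w u (DistortedStopping.expMartingale c s B) τ :=
    iSup₂_le fun p hp => le_iSup₂_of_le _
      (DistortedStopping.exitTime_mem_stoppingTimes hB hc hp)
      (DistortedStopping.distortedPayoff_exitTime hB hc hw hu hp).ge
  have hX : (⨆ τ ∈ DistortedStopping.stoppingTimes F P,
        DistortedStopping.distortedPayoff P w u (DistortedStopping.expMartingale c s B) τ) ≤
      ⨆ x ∈ Set.Ioc (0 : ℝ) 1, ENNReal.ofReal (w x * u (s / x)) :=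
    iSup₂_le fun τ hτ => DistortedStopping.distortedPayoff_le hB hs0 hw hu hconv hτ
  have hT : (⨆ x ∈ Set.Ioc (0 : ℝ) 1, ENNReal.ofReal (w x * u (s / x))) ≤
      ⨆ p ∈ DistortedStopping.thresholds s,
        ENNReal.ofReal (DistortedStopping.twoThreshold w u s p) :=
    iSup₂_le fun x hx => DistortedStopping.ofReal_le_iSup_twoThreshold hw hu hs0 hx
  refine ⟨le_antisymm (hX.trans hT) hJ, le_antisymm (hJ.trans hX) hT, fun a b hab hmax => ?_⟩
  refine ⟨DistortedStopping.exitTime_mem_stoppingTimes hB hc hab, fun ρ hρ => ?_⟩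
  rw [DistortedStopping.distortedPayoff_exitTime hB hc hw hu hab]
  refine (DistortedStopping.distortedPayoff_le hB hs0 hw hu hconv hρ).trans (hT.trans ?_)
  exact iSup₂_le fun p hp => ENNReal.ofReal_le_ofReal (hmax hp)
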